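/- All graphs are finite, simple and undirected. A \emph{nut graph} is a graph whose adjacency matrix $A$ (over $\mathbb{R}$) has a one-dimensional null space that is spanned by a vector having no zero entry. For a graph $\Gamma$, let $o_v$ and $o_e$ denote the numbers of orbits of its full automorphism group $\mathrm{Aut}(\Gamma)$ on the vertices and on the edges of $\Gamma$, respectively. Let $n \ge 3$ be an odd integer. (1) Let $m \ge 1$ be an odd integer and let $t \ge 2$ be an even integer, with factorizations \[ m = m_0\Big(\prod_{i=1}^{r_1} m_i\Big)\Big(\prod_{i=1}^{q_1} m_i'\Big), \qquad t = t_0\Big(\prod_{j=1}^{r_2} t_j\Big)\Big(\prod_{j=1}^{q_2} t_j'\Big), \] where $r_1,q_1,r_2,q_2 \ge 0$ and $m_0,t_0 \ge 1$ are integers, $m_1,\dots,m_{r_1},t_1,\dots,t_{r_2}$ are (not necessarily distinct) odd primes, and $m_1',\dots,m_{q_1}',t_1',\dots,t_{q_2}' \ge 2$ are integers (empty products are $1$). Suppose that there are even divisors $d_i$ of $m_i-1$ for $1\le i\le r_1$, even divisors $d_j'$ of $t_j-1$ for $1\le j\le r_2$, and $\kappa\in\{2,4\}$ such that \[ \kappa\Big(\prod_{i=1}^{r_1}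 d_i\Big)\Big(\prod_{j=1}^{r_2} d_j'\Big)\Big(\prod_{i=1}^{q_1}(m_i'-1)\Big)\Big(\prod_{j=1}^{q_2}(t_j'-1)\Big) = mt \] and \[ t + 2\Big(\prod_{i=1}^{r_1} d_i\Big)\Big(\prod_{i=1}^{q_1}(m_i'-1)\Big) \ne m + \frac{\kappa}{2}\Big(\prod_{j=1}^{r_2} d_j'\Big)\Big(\prod_{j=1}^{q_2}(t_j'-1)\Big). \] Then there exists a nut graph with $(o_v,o_e)=(2,3)$ of order $n(m+t)$. (2) In particular, there exists a nut graph with $(o_v,o_e)=(2,3)$ of order $ns$ for each \[ s \in \{3, 5, 7, 11, 13, 29, 31, 37, 41, 47, 53, 59, 83, 101, 103, 109, 127, 131, 137, 139\}. \] -/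

import Mathlib

namespace NutGraphs

/-- The number of vertex orbits `o_v` of the full automorphism group of `G`. -/
noncomputable def vertexOrbitCount {V : Type*} (G : SimpleGraph V) : ℕ :=
  Nat.card (MulAction.orbitRel.Quotient (G ≃g G) V)

/-- Two edges of `G` are equivalent when some automorphism of `G` maps one to the other. -/
def edgeOrbitSetoid {V : Type*} (G : SimpleGraph V) : Setoid G.edgeSet where
  r e f := ∃ φ : G ≃g G, φ.mapEdgeSet e = f
  iseqv :=
    { refl := fun e => ⟨SimpleGraph.Iso.refl, by ext; simp⟩
      symm := by
        rintro e f ⟨φ, rfl⟩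
        exact ⟨φ.symm, φ.mapEdgeSet.symm_apply_apply e⟩
      trans := by
        rintro e f g ⟨φ, rfl⟩ ⟨ψ, rfl⟩
        exact ⟨φ.trans ψ, by ext; simp [Sym2.map_map]⟩ }

/-- The number of edge orbits `o_e` of the full automorphism group of `G`. -/
noncomputable def edgeOrbitCount {V : Type*} (G : SimpleGraph V) : ℕ :=
  Nat.card (Quotient (edgeOrbitSetoid G))

open Classical in
/-- A nut graph: the null space of the (real) adjacency matrix is one-dimensional and is spanned
by a vector without zero entries. -/
def IsNut {V : Type*} [Fintype V] (G : SimpleGraph V) : Prop :=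
  Module.finrank ℝ (LinearMap.ker (G.adjMatrix ℝ).mulVecLin) = 1 ∧
    ∃ x : V → ℝ, (∀ v, x v ≠ 0) ∧
      LinearMap.ker (G.adjMatrix ℝ).mulVecLin = Submodule.span ℝ {x}

/-- There is a nut graph of order `N` with `(o_v, o_e) = (2, 3)`. -/
def ExistsNutGraphTwoThree (N : ℕ) : Prop :=
  ∃ (V : Type) (_ : Fintype V) (G : SimpleGraph V),
    Fintype.card V = N ∧ IsNut G ∧ vertexOrbitCount G = 2 ∧ edgeOrbitCount G = 3

end NutGraphs

/-! Let `Z = ZMod n`, and take symmetric relations `C`, `D` on `Z`, `R` on `X`, `S` on `Y`, where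
`|X| = m` and `|Y| = t`. The graph lives on `Z × X ⊔ Z × Y`: it is `C × R` on the left, `D × S` on
the right, and complete bipartite between the two fibres over each point of `Z`. All four relations
are arc-transitive, regular (degrees `γ, δ, α, β`) and nonsingular. Here `C` is the odd cycle, and
`D` is the cycle (`κ = 4`) or equality (`κ = 2`), so `γδ = κ`.

Nullity: on a null vector, `C × R` and `D × S` return fibre sums of the other part, so by
nonsingularity the vector is constant on fibres (`eq_fibre_mean`). Eliminating one part leaves `D C
E = (mt / αβ) E` on `Z`. The product condition says that the scalar is `γδ`, the top eigenvalue of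
`D C`. It is simple, so `E` is constant and the null space is a line (`isNut_blockGraph`).

Orbits: the inequality says that the two parts have different degrees, so automorphisms preserve
them. Arc-transitivity then merges everything else, leaving two vertex orbits and one edge orbit for
each unordered pair of parts.

`R` and `S` are products of equality relations (degree 1), complete graphs, and cyclotomic graphs on
`ZMod p`; the last are nonsingular by reduction modulo `p`. -/

namespace NutGraphs

/-! ### Arc-transitive regular nonsingular relations and their products -/

section ArcRegular

variable {X Y Z : Type} [Fintype X] [Fintype Y] [Fintype Z]

open Classical in
/-- The adjacency operator of a relation. -/
noncomputable def relOp (R : X → X → Prop) : (X → ℝ) →ₗ[ℝ] (X → ℝ) :=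
  (Matrix.of fun x y => if R x y then (1 : ℝ) else 0).mulVecLin

open Classical in
lemma relOp_apply (R : X → X → Prop) (f : X → ℝ) (x : X) :
    relOp R f x = ∑ y, if R x y then f y else 0 := by
  simp [relOp, Matrix.mulVec, dotProduct]

/-- A permutation preserving a relation in both directions. -/
def Preserves (σ : Equiv.Perm X) (R : X → X → Prop) : Prop := ∀ x y, R (σ x) (σ y) ↔ R x y

/-- A symmetric, arc-transitive relation (loops allowed), regular of degree `a`, with nonsingular
adjacency operator. -/
structure ArcRegular (R : X → X → Prop) (a : ℕ) : Prop where
  symm : ∀ x y, R x y → R y x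
  arc : ∀ x y x' y', R x y → R x' y' → ∃ σ : Equiv.Perm X, Preserves σ R ∧ σ x = x' ∧ σ y = y'
  deg : relOp R (fun _ => 1) = fun _ => (a : ℝ)
  inj : ∀ f, relOp R f = 0 → f = 0

/-- The product of two relations. -/
def prodRel (R : X → X → Prop) (S : Y → Y → Prop) : X × Y → X × Y → Prop :=
  fun p q => R p.1 q.1 ∧ S p.2 q.2

lemma relOp_prodRel (R : X → X → Prop) (S : Y → Y → Prop) (f : X × Y → ℝ) (p : X × Y) :
    relOp (prodRel R S) f p = relOp R (fun x => relOp S (fun y => f (x, y)) p.2) p.1 := by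
  classical
  simp only [relOp_apply, prodRel, Fintype.sum_prod_type]
  refine Finset.sum_congr rfl fun x _ => ?_
  by_cases h : R p.1 x <;> simp [h]

lemma relOp_const {R : X → X → Prop} {a : ℕ} (h : ArcRegular R a) (c : ℝ) (x : X) :
    relOp R (fun _ => c) x = a * c := by
  have h1 : (fun _ : X => c) = c • (fun _ : X => (1 : ℝ)) := by ext; simp
  rw [h1, map_smul, h.deg]
  simp [mul_comm]

/-- By symmetry the column sums equal the row sums `a`. -/
lemma sum_relOp {R : X → X → Prop} {a : ℕ} (h : ArcRegular R a) (f : X → ℝ) :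
    ∑ x, relOp R f x = a * ∑ x, f x := by
  classical
  simp only [relOp_apply]
  rw [Finset.sum_comm, Finset.mul_sum]
  refine Finset.sum_congr rfl fun y _ => ?_
  rw [← relOp_const h (f y) y, relOp_apply]
  refine Finset.sum_congr rfl fun x _ => ?_
  have : R x y ↔ R y x := ⟨h.symm _ _, h.symm _ _⟩
  simp [this]

lemma ArcRegular.exists_rel {R : X → X → Prop} {a : ℕ} (h : ArcRegular R a) (ha : 0 < a)
    (x : X) : ∃ y, R x y := by
  classical
  by_contra! hx
  have h1 := congrFun h.deg x
  rw [relOp_apply] at h1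
  simp only [hx, if_false, Finset.sum_const_zero] at h1
  have : a = 0 := by exact_mod_cast h1.symm
  omega

lemma ArcRegular.exists_preserves {R : X → X → Prop} {a : ℕ} (h : ArcRegular R a) (ha : 0 < a)
    (x x' : X) : ∃ σ : Equiv.Perm X, Preserves σ R ∧ σ x = x' := by
  obtain ⟨y, hy⟩ := h.exists_rel ha x
  obtain ⟨y', hy'⟩ := h.exists_rel ha x'
  obtain ⟨σ, h1, h2, -⟩ := h.arc _ _ _ _ hy hy'
  exact ⟨σ, h1, h2⟩

/-- The product operator is a tensor product: cancel `R` for each fixed `y`, then `S` for each fixed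
`x`. -/
lemma relOp_prodRel_eq_zero {R : X → X → Prop} {S : Y → Y → Prop}
    (hR : ∀ f, relOp R f = 0 → f = 0) (hS : ∀ f, relOp S f = 0 → f = 0) (f : X × Y → ℝ)
    (hf : relOp (prodRel R S) f = 0) : f = 0 := by
  have h1 : ∀ y, (fun x => relOp S (fun y => f (x, y)) y) = 0 := fun y =>
    hR _ (funext fun x => by simpa [relOp_prodRel] using congrFun hf (x, y))
  have h2 : ∀ x, (fun y => f (x, y)) = 0 := fun x =>
    hS _ (funext fun y => congrFun (h1 y) x)
  ext ⟨x, y⟩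
  exact congrFun (h2 x) y

omit [Fintype X] [Fintype Y] in
lemma Preserves.prod {R : X → X → Prop} {S : Y → Y → Prop} {σ : Equiv.Perm X}
    {τ : Equiv.Perm Y} (hσ : Preserves σ R) (hτ : Preserves τ S) :
    Preserves (Equiv.prodCongr σ τ) (prodRel R S) := by
  intro p q
  simp [prodRel, hσ p.1 q.1, hτ p.2 q.2]

lemma ArcRegular.prod {R : X → X → Prop} {S : Y → Y → Prop} {a b : ℕ}
    (hR : ArcRegular R a) (hS : ArcRegular S b) : ArcRegular (prodRel R S) (a * b) where
  symm p q h := ⟨hR.symm _ _ h.1, hS.symm _ _ h.2⟩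
  arc p q p' q' h h' := by
    obtain ⟨σ, h1, h2, h3⟩ := hR.arc _ _ _ _ h.1 h'.1
    obtain ⟨τ, k1, k2, k3⟩ := hS.arc _ _ _ _ h.2 h'.2
    exact ⟨Equiv.prodCongr σ τ, h1.prod k1, by ext <;> simp [h2, k2], by ext <;> simp [h3, k3]⟩
  deg := by
    ext p
    rw [relOp_prodRel]
    simp only [relOp_const hS, relOp_const hR]
    push_cast
    ring
  inj := relOp_prodRel_eq_zero hR.inj hS.inj

lemma relOp_eq (f : X → ℝ) : relOp (fun x y : X => x = y) f = f := by
  classical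
  ext x
  simp [relOp_apply]

lemma arcRegular_eq : ArcRegular (fun x y : X => x = y) 1 := by
  classical
  refine ⟨fun x y h => h.symm, ?_, by simp [relOp_eq], fun f hf => by rwa [relOp_eq] at hf⟩
  rintro x _ x' _ rfl rfl
  exact ⟨Equiv.swap x x', fun a b => by simp, by simp, by simp⟩

/-- The operator is `J - I`: a null vector equals its own total everywhere, so `(|X| - 1)` times
that total vanishes. -/
lemma arcRegular_ne (hX : 2 ≤ Fintype.card X) :
    ArcRegular (fun x y : X => x ≠ y) (Fintype.card X - 1) := by
  classical
  have key : ∀ (f : X → ℝ) x, relOp (fun x y : X => x ≠ y) f x = ∑ y, f y - f x := by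
    intro f x
    rw [relOp_apply, eq_sub_iff_add_eq]
    have : f x = ∑ y, if x = y then f y else 0 := by simp
    rw [this, ← Finset.sum_add_distrib]
    refine Finset.sum_congr rfl fun y _ => ?_
    by_cases h : x = y <;> simp [h]
  refine ⟨fun x y h => h.symm, ?_, ?_, ?_⟩
  · intro x y x' y' h h'
    -- The first swap sends `x` to `x'`; the second sends the image of `y` to `y'` and fixes `x'`.
    refine ⟨(Equiv.swap x x').trans (Equiv.swap (Equiv.swap x x' y) y'), fun a b => by simp, ?_, ?_⟩
    · have : x' ≠ Equiv.swap x x' y := by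
        intro hh
        apply h
        apply (Equiv.swap x x').injective
        simpa using hh
      simp [Equiv.swap_apply_of_ne_of_ne this h']
    · simp
  · ext x
    rw [key, Nat.cast_sub (by omega)]
    simp
  · intro f hf
    have h1 : ∀ x, f x = ∑ y, f y := fun x => by
      have := congrFun hf x
      rw [key] at this
      simp only [Pi.zero_apply] at this
      linarith
    have h2 : ∑ y, f y = Fintype.card X * ∑ y, f y := by
      conv_lhs => rw [Finset.sum_congr rfl fun x _ => h1 x]
      simp
    have h3 : (2 : ℝ) ≤ Fintype.card X := by exact_mod_cast hX
    have h4 : ((Fintype.card X : ℝ) - 1) * ∑ y, f y = 0 := by linarith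
    have h5 : ∑ y, f y = 0 := by
      rcases mul_eq_zero.1 h4 with h | h
      · linarith
      · exact h
    ext x
    simp [h1 x, h5]

end ArcRegular

/-! ### Cyclotomic graphs on `ZMod p` -/

section Cyclotomic

/-- The relation `y - x ∈ H` on `ZMod p`, where `H` is the group of `d`-th roots of unity. -/
def rootRel (p d : ℕ) : ZMod p → ZMod p → Prop := fun x y => (y - x) ^ d = 1

lemma card_pow_eq_one {p d : ℕ} [Fact p.Prime] (hd : d ∣ p - 1) :
    (Finset.univ.filter fun h : ZMod p => h ^ d = 1).card = d := by
  classical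
  have hp := (Fact.out : p.Prime)
  have hp1 : 0 < p - 1 := by have := hp.two_le; omega
  have hd0 : 0 < d := Nat.pos_of_dvd_of_pos hd hp1
  obtain ⟨g, hg⟩ := IsCyclic.exists_generator (α := (ZMod p)ˣ)
  have ho : orderOf g = p - 1 := by
    rw [orderOf_eq_card_of_forall_mem_zpowers hg, Nat.card_eq_fintype_card, ZMod.card_units]
  have h1 : IsPrimitiveRoot (g : ZMod p) (p - 1) :=
    IsPrimitiveRoot.coe_units_iff.2 (ho ▸ IsPrimitiveRoot.orderOf g)
  obtain ⟨c, hc⟩ := hd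
  have h2 : IsPrimitiveRoot ((g : ZMod p) ^ c) d := h1.pow hp1 (by rw [hc, mul_comm])
  refine Eq.trans ?_ h2.card_nthRootsFinset
  congr 1
  ext h
  simp [Polynomial.mem_nthRootsFinset hd0]

-- The operator is `P(T)`, with `T` the unit shift and `P = ∑ X ^ h`. In characteristic `p`, `P ^ p
-- = ∑ X ^ (h p)`, and `T ^ p = 1`, so `P(T) ^ p = d`, a nonzero scalar because `0 < d < p`.
open Polynomial in
lemma sum_shift_eq_zero {p d : ℕ} [Fact p.Prime] (hd : d ∣ p - 1) (f : ZMod p → ZMod p)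
    (hf : ∀ x, ∑ h with h ^ d = 1, f (x + h) = 0) : f = 0 := by
  have hp := (Fact.out : p.Prime)
  have hp1 : 0 < p - 1 := by have := hp.two_le; omega
  let T : Module.End (ZMod p) (ZMod p → ZMod p) := LinearMap.funLeft (ZMod p) (ZMod p) (· + 1)
  have hT : ∀ (k : ℕ) (g : ZMod p → ZMod p) x, (T ^ k) g x = g (x + k) := by
    intro k
    induction k with
    | zero => simp
    | succ k ih =>
      intro g x
      rw [pow_succ, Module.End.mul_apply, ih]
      simp [T, LinearMap.funLeft_apply, add_assoc]
  let H : Finset (ZMod p) := Finset.univ.filter fun h => h ^ d = 1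
  let P : (ZMod p)[X] := ∑ h ∈ H, X ^ h.val
  have h1 : aeval T P f = 0 := by
    ext x
    simp only [P, map_sum, map_pow, aeval_X, LinearMap.sum_apply, Finset.sum_apply, hT,
      ZMod.natCast_zmod_val]
    exact hf x
  have h2 : aeval T (P ^ p) f = (d : ZMod p) • f := by
    have : P ^ p = ∑ h ∈ H, X ^ (h.val * p) := by
      rw [sum_pow_char]
      simp [pow_mul]
    rw [this]
    ext x
    simp only [map_sum, map_pow, aeval_X, LinearMap.sum_apply, Finset.sum_apply, hT]
    simp [H, card_pow_eq_one hd]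
  have h3 : aeval T (P ^ p) f = 0 := by
    obtain ⟨k, hk⟩ : ∃ k, p = k + 1 := ⟨p - 1, by omega⟩
    have : P ^ p = P ^ k * P := by rw [← pow_succ, ← hk]
    rw [this, map_mul, Module.End.mul_apply, h1, map_zero]
  rw [h2] at h3
  refine (smul_eq_zero.1 h3).resolve_left fun h0 => ?_
  rw [ZMod.natCast_eq_zero_iff] at h0
  have := Nat.le_of_dvd (Nat.pos_of_dvd_of_pos hd hp1) h0
  have := Nat.le_of_dvd hp1 hd
  omega

/-- The matrix has integer entries and its determinant is nonzero modulo `p`, hence nonzero over the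
reals. -/
lemma relOp_rootRel_eq_zero {p d : ℕ} [Fact p.Prime] (hd : d ∣ p - 1) (f : ZMod p → ℝ)
    (hf : relOp (rootRel p d) f = 0) : f = 0 := by
  classical
  let A : Matrix (ZMod p) (ZMod p) ℤ := Matrix.of fun x y => if rootRel p d x y then 1 else 0
  have h1 : (A.map (Int.castRingHom (ZMod p))).det ≠ 0 := by
    intro h0
    obtain ⟨v, hv, hAv⟩ := Matrix.exists_mulVec_eq_zero_iff.2 h0
    refine hv (sum_shift_eq_zero hd v fun x => ?_)
    have := congrFun hAv x
    simp only [Matrix.mulVec, dotProduct, A, Matrix.map_apply, Matrix.of_apply,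
      Pi.zero_apply] at this
    rw [← this, Finset.sum_filter]
    conv_rhs => rw [← Equiv.sum_comp (Equiv.addLeft x)]
    refine Finset.sum_congr rfl fun h _ => ?_
    by_cases hh : h ^ d = 1 <;> simp [rootRel, hh]
  by_contra h0
  refine h1 ?_
  have h2 : (A.map (Int.castRingHom ℝ)).det = 0 := by
    refine Matrix.exists_mulVec_eq_zero_iff.1 ⟨f, h0, ?_⟩
    rw [← hf]
    ext x
    simp only [Matrix.mulVec, dotProduct, A, Matrix.map_apply, Matrix.of_apply, relOp_apply]
    refine Finset.sum_congr rfl fun y _ => ?_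
    by_cases hh : rootRel p d x y <;> simp
  have h3 : A.det = 0 := by
    rw [← RingHom.mapMatrix_apply, ← RingHom.map_det] at h2
    simpa using h2
  rw [← RingHom.mapMatrix_apply, ← RingHom.map_det, h3, map_zero]

/-- Symmetry needs `(-1) ^ d = 1`, hence `d` even. The affine maps `z ↦ c z + b` with `c ^ d = 1`
are transitive on arcs. -/
lemma arcRegular_rootRel {p d : ℕ} [Fact p.Prime] (hd : d ∣ p - 1) (he : Even d) :
    ArcRegular (rootRel p d) d where
  symm x y h := by
    unfold rootRel at *
    rw [← neg_sub, he.neg_pow, h]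
  arc x y x' y' h h' := by
    have hp := (Fact.out : p.Prime)
    have hd0 : d ≠ 0 := by
      rintro rfl
      have := hp.two_le
      have := Nat.eq_zero_of_zero_dvd hd
      omega
    unfold rootRel at h h'
    have n1 : y - x ≠ 0 := fun h0 => by simp [h0, hd0] at h
    have n2 : y' - x' ≠ 0 := fun h0 => by simp [h0, hd0] at h'
    let c : ZMod p := (y' - x') / (y - x)
    have hc : c ≠ 0 := div_ne_zero n2 n1
    have hcd : c ^ d = 1 := by simp [c, div_pow, h, h']
    refine ⟨(Equiv.mulLeft₀ c hc).trans (Equiv.addRight (x' - c * x)), fun a b => ?_, ?_, ?_⟩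
    · simp [rootRel, ← mul_sub, mul_pow, hcd]
    · simp
    · have : c * (y - x) = y' - x' := by simp [c, n1]
      change c * y + (x' - c * x) = y'
      linear_combination this
  deg := by
    classical
    ext x
    rw [relOp_apply, ← Equiv.sum_comp (Equiv.addLeft x)]
    simp [rootRel, card_pow_eq_one hd]
  inj := relOp_rootRel_eq_zero hd

end Cyclotomic

/-! ### The odd cycle and the simplicity of its top eigenvalue -/

section Cycle

/-- The adjacency relation of the cycle on `ZMod n`. -/
def cycleRel (n : ℕ) : ZMod n → ZMod n → Prop := fun i j => j = i + 1 ∨ j = i - 1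

lemma two_ne_zero_zmod {n : ℕ} (hn : 3 ≤ n) : (2 : ZMod n) ≠ 0 := by
  intro h
  have : ((2 : ℕ) : ZMod n) = 0 := by exact_mod_cast h
  rw [ZMod.natCast_eq_zero_iff] at this
  have := Nat.le_of_dvd (by norm_num) this
  omega

lemma relOp_cycleRel {n : ℕ} [NeZero n] (hn : 3 ≤ n) (f : ZMod n → ℝ) (i : ZMod n) :
    relOp (cycleRel n) f i = f (i + 1) + f (i - 1) := by
  classical
  have h2 : i + 1 ≠ i - 1 := fun h => two_ne_zero_zmod hn (by linear_combination h)
  rw [relOp_apply, ← Finset.sum_pair (f := f) h2, ← Finset.sum_filter]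
  refine Finset.sum_congr ?_ fun _ _ => rfl
  ext j
  simp only [Finset.mem_filter, Finset.mem_univ, true_and, Finset.mem_insert,
    Finset.mem_singleton]
  rfl

lemma arcRegular_cycleRel {n : ℕ} [NeZero n] (hn : 3 ≤ n) (hodd : Odd n) :
    ArcRegular (cycleRel n) 2 where
  symm i j h := by
    rcases h with h | h
    · right; rw [h]; ring
    · left; rw [h]; ring
  arc i j i' j' h h' := by
    have e1 : ∀ a b : ZMod n, cycleRel n a b ↔ b - a = 1 ∨ b - a = -1 := by
      intro a b
      refine or_congr ⟨fun h => ?_, fun h => ?_⟩ ⟨fun h => ?_, fun h => ?_⟩ <;>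
        linear_combination h
    have key : (j' - i' = j - i) ∨ (j' - i' = -(j - i)) := by
      rw [e1] at h h'
      rcases h with h | h <;> rcases h' with h' | h' <;> simp [h, h']
    rcases key with key | key
    · refine ⟨Equiv.addRight (i' - i), fun a b => by simp [e1], by simp, ?_⟩
      simp only [Equiv.coe_addRight]
      linear_combination -key
    · refine ⟨Equiv.subLeft (i' + i), fun a b => ?_, by simp, ?_⟩
      · simp only [e1, Equiv.subLeft_apply]
        rw [or_comm]
        refine or_congr ⟨fun h => ?_, fun h => ?_⟩ ⟨fun h => ?_, fun h => ?_⟩ <;>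
          linear_combination -h
      · simp only [Equiv.subLeft_apply]
        linear_combination -key
  deg := by
    ext i
    rw [relOp_cycleRel hn]
    norm_num
  inj f hf := by
    -- Iterating this `n` times returns to `i` with sign `(-1) ^ n = -1`.
    have h1 : ∀ i, f (i + 2) = - f i := by
      intro i
      have := congrFun hf (i + 1)
      rw [relOp_cycleRel hn, add_sub_cancel_right, add_assoc, one_add_one_eq_two] at this
      simp only [Pi.zero_apply] at this
      linarith
    have h2 : ∀ (k : ℕ) i, f (i + 2 * k) = (-1) ^ k * f i := by
      intro k
      induction k with
      | zero => simp
      | succ k ih =>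
        intro i
        have : i + 2 * ((k + 1 : ℕ) : ZMod n) = (i + 2 * k) + 2 := by push_cast; ring
        rw [this, h1, ih, pow_succ]
        ring
    ext i
    have := h2 n i
    rw [hodd.neg_one_pow] at this
    simp only [CharP.cast_eq_zero, mul_zero, add_zero] at this
    simp only [Pi.zero_apply]
    linarith

/-- Energy argument: the hypothesis forces `∑ (f (i + s) - f i) ^ 2 = 0`, so `f` is invariant under
the shift by `s`, which generates `ZMod n`. -/
lemma const_of_shift_mean {n : ℕ} [NeZero n] (f : ZMod n → ℝ) (s : ZMod n) (hs : IsUnit s)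
    (hf : ∀ i, f (i + s) + f (i - s) = 2 * f i) : ∃ c, ∀ i, f i = c := by
  have h1 : ∑ i, f i * f (i - s) = ∑ i, f i * f (i + s) := by
    rw [← Equiv.sum_comp (Equiv.addRight s)]
    refine Finset.sum_congr rfl fun i _ => ?_
    simp [mul_comm]
  have h2 : ∑ i, f (i + s) ^ 2 = ∑ i, f i ^ 2 :=
    Equiv.sum_comp (Equiv.addRight s) fun i => f i ^ 2
  have h3 : ∑ i, f i * f (i + s) + ∑ i, f i * f (i - s) = 2 * ∑ i, f i ^ 2 := by
    rw [← Finset.sum_add_distrib, Finset.mul_sum]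
    refine Finset.sum_congr rfl fun i _ => ?_
    rw [← mul_add, hf]
    ring
  have h4 : ∑ i, (f (i + s) - f i) ^ 2 = 0 := by
    have : ∑ i, (f (i + s) - f i) ^ 2
        = ∑ i, f (i + s) ^ 2 + ∑ i, f i ^ 2 - 2 * ∑ i, f i * f (i + s) := by
      rw [Finset.mul_sum, ← Finset.sum_add_distrib, ← Finset.sum_sub_distrib]
      refine Finset.sum_congr rfl fun i _ => ?_
      ring
    rw [this, h2]
    linarith
  have h5 : ∀ i, f (i + s) = f i := by
    intro i
    have := (Finset.sum_eq_zero_iff_of_nonneg (fun i _ => sq_nonneg _)).1 h4 i (Finset.mem_univ i)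
    have := pow_eq_zero_iff (two_ne_zero) |>.1 this
    linarith
  have h6 : ∀ (k : ℕ), f (k * s) = f 0 := by
    intro k
    induction k with
    | zero => simp
    | succ k ih =>
      rw [← ih, ← h5 (k * s)]
      congr 1
      push_cast
      ring
  refine ⟨f 0, fun i => ?_⟩
  obtain ⟨u, rfl⟩ := hs
  rw [← h6 (i * (↑u⁻¹ : ZMod n)).val]
  simp

lemma const_of_relOp_cycleRel {n : ℕ} [NeZero n] (hn : 3 ≤ n) (f : ZMod n → ℝ)
    (hf : ∀ i, relOp (cycleRel n) f i = 2 * f i) : ∃ c, ∀ i, f i = c :=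
  const_of_shift_mean f 1 isUnit_one fun i => by rw [← relOp_cycleRel hn, hf]

/-- The squared operator compares `f i` with `f (i ± 2)`, and `2` is a unit because `n` is odd. -/
lemma const_of_relOp_cycleRel_sq {n : ℕ} [NeZero n] (hn : 3 ≤ n) (hodd : Odd n) (f : ZMod n → ℝ)
    (hf : ∀ i, relOp (cycleRel n) (relOp (cycleRel n) f) i = 4 * f i) : ∃ c, ∀ i, f i = c := by
  refine const_of_shift_mean f 2 ?_ fun i => ?_
  · have := (ZMod.unitOfCoprime 2 (Nat.coprime_two_left.2 hodd) : (ZMod n)ˣ).isUnit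
    simpa using this
  · have := hf i
    simp only [relOp_cycleRel hn] at this
    have e1 : i + 1 + 1 = i + 2 := by ring
    have e2 : i - 1 - 1 = i - 2 := by ring
    simp only [e1, e2, add_sub_cancel_right, sub_add_cancel] at this
    linarith

end Cycle

/-! ### The block graph: nullity and orbits -/

section Block

variable {X Y Z : Type} [Fintype X] [Fintype Y] [Fintype Z]

/-- The adjacency relation on the disjoint union of `Z × X` and `Z × Y` given by `C × R` and
`D × S` inside the parts, and by equality of the first coordinates between the parts. -/
def blockRel (C D : Z → Z → Prop) (R : X → X → Prop) (S : Y → Y → Prop) :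
    (Z × X) ⊕ (Z × Y) → (Z × X) ⊕ (Z × Y) → Prop
  | .inl p, .inl q => prodRel C R p q
  | .inl p, .inr q => p.1 = q.1
  | .inr p, .inl q => p.1 = q.1
  | .inr p, .inr q => prodRel D S p q

variable {C D : Z → Z → Prop} {R : X → X → Prop} {S : Y → Y → Prop} {α β γ δ : ℕ}

lemma relOp_blockRel_inl (f : (Z × X) ⊕ (Z × Y) → ℝ) (p : Z × X) :
    relOp (blockRel C D R S) f (.inl p) =
      relOp (prodRel C R) (fun q => f (.inl q)) p + ∑ w, f (.inr (p.1, w)) := by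
  classical
  simp only [relOp_apply, Fintype.sum_sum_type, blockRel]
  congr 1
  rw [Fintype.sum_prod_type, Finset.sum_comm]
  refine Finset.sum_congr rfl fun w _ => ?_
  exact (Finset.sum_eq_single p.1 (fun z _ hz => if_neg (Ne.symm hz))
    fun h => absurd (Finset.mem_univ _) h).trans (if_pos rfl)

lemma relOp_blockRel_inr (f : (Z × X) ⊕ (Z × Y) → ℝ) (p : Z × Y) :
    relOp (blockRel C D R S) f (.inr p) =
      relOp (prodRel D S) (fun q => f (.inr q)) p + ∑ u, f (.inl (p.1, u)) := by
  classical
  simp only [relOp_apply, Fintype.sum_sum_type, blockRel]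
  rw [add_comm]
  congr 1
  rw [Fintype.sum_prod_type, Finset.sum_comm]
  refine Finset.sum_congr rfl fun w _ => ?_
  exact (Finset.sum_eq_single p.1 (fun z _ hz => if_neg (Ne.symm hz))
    fun h => absurd (Finset.mem_univ _) h).trans (if_pos rfl)

/-- The block relation is symmetric and loopless when its constituents allow it. -/
def blockGraph (hC : ArcRegular C γ) (hD : ArcRegular D δ) (hR : ArcRegular R α)
    (hS : ArcRegular S β) (lC : ∀ z, ¬ C z z) (lD : ∀ z y, ¬ (D z z ∧ S y y)) :
    SimpleGraph ((Z × X) ⊕ (Z × Y)) where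
  Adj := blockRel C D R S
  symm := ⟨by
    rintro (p | p) (q | q) h
    · exact (hC.prod hR).symm _ _ h
    · exact Eq.symm h
    · exact Eq.symm h
    · exact (hD.prod hS).symm _ _ h⟩
  loopless := ⟨by
    rintro (p | p) h
    · exact lC _ h.1
    · exact lD _ _ h⟩

lemma isNut_iff_relOp {V : Type} [Fintype V] (G : SimpleGraph V) :
    IsNut G ↔ Module.finrank ℝ (LinearMap.ker (relOp G.Adj)) = 1 ∧
      ∃ x : V → ℝ, (∀ v, x v ≠ 0) ∧ LinearMap.ker (relOp G.Adj) = Submodule.span ℝ {x} :=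
  Iff.rfl

lemma isNut_of_eigenvector {V : Type} [Fintype V] [Nonempty V] (G : SimpleGraph V) (x : V → ℝ)
    (hx : ∀ v, x v ≠ 0) (hker : relOp G.Adj x = 0)
    (hspan : ∀ f, relOp G.Adj f = 0 → ∃ c : ℝ, f = c • x) : IsNut G := by
  have h : LinearMap.ker (relOp G.Adj) = Submodule.span ℝ {x} := by
    refine le_antisymm (fun f hf => ?_) ?_
    · obtain ⟨c, rfl⟩ := hspan f hf
      exact Submodule.mem_span_singleton.2 ⟨c, rfl⟩
    · rw [Submodule.span_singleton_le_iff_mem]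
      exact hker
  refine (isNut_iff_relOp G).2 ⟨?_, x, hx, h⟩
  rw [h]
  refine finrank_span_singleton fun h0 => ?_
  obtain ⟨v⟩ := ‹Nonempty V›
  exact hx v (by simp [h0])

/-- If `(C × R) f` depends only on the first coordinate, so does `f`. -/
lemma eq_fibre_mean (hC : ∀ f, relOp C f = 0 → f = 0) (hR : ArcRegular R α) [Nonempty X]
    (f : Z × X → ℝ) (g : Z → ℝ) (hf : ∀ p, relOp (prodRel C R) f p = g p.1) :
    (∀ z, α * relOp C (fun z => ∑ x, f (z, x)) z = Fintype.card X * g z) ∧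
      ∀ p, f p = (∑ x, f (p.1, x)) / Fintype.card X := by
  have hX : (Fintype.card X : ℝ) ≠ 0 := by simp
  have hsum : ∀ z, α * relOp C (fun z => ∑ x, f (z, x)) z = Fintype.card X * g z := by
    intro z
    have h1 : ∑ x, relOp (prodRel C R) f (z, x) = Fintype.card X * g z := by simp [hf]
    rw [← h1]
    simp only [relOp_prodRel]
    classical
    simp only [relOp_apply C]
    rw [Finset.sum_comm, Finset.mul_sum]
    refine Finset.sum_congr rfl fun z' _ => ?_
    by_cases h : C z z'
    · simp only [h, if_true]
      rw [sum_relOp hR]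
    · simp [h]
  refine ⟨hsum, fun p => ?_⟩
  -- Replacing `f` by its fibre means does not change its image, so the difference is a null vector.
  have h0 := relOp_prodRel_eq_zero hC hR.inj
    (f - fun p => (Fintype.card X : ℝ)⁻¹ * ∑ x, f (p.1, x)) ?_
  · have := congrFun h0 p
    simp only [Pi.sub_apply, Pi.zero_apply] at this
    rw [div_eq_inv_mul]
    linarith
  · ext p
    rw [map_sub, Pi.sub_apply, hf, relOp_prodRel]
    simp only [relOp_const hR]
    have h2 : (fun z => (α : ℝ) * ((Fintype.card X : ℝ)⁻¹ * ∑ x, f (z, x)))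
        = (α * (Fintype.card X : ℝ)⁻¹) • fun z => ∑ x, f (z, x) := by
      ext z; simp [mul_assoc]
    rw [h2, map_smul]
    have h3 := hsum p.1
    simp only [Pi.smul_apply, smul_eq_mul, Pi.zero_apply]
    rw [mul_right_comm, h3]
    field_simp
    ring

variable (hC : ArcRegular C γ) (hD : ArcRegular D δ) (hR : ArcRegular R α)
  (hS : ArcRegular S β) (lC : ∀ z, ¬ C z z) (lD : ∀ z y, ¬ (D z z ∧ S y y))

/-- `hconst` says that `γδ` is a simple eigenvalue of `D C`, constants always being eigenvectors for
it. -/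
lemma isNut_blockGraph [Nonempty X] [Nonempty Y] [Nonempty Z]
    (hdet : γ * α * (δ * β) = Fintype.card X * Fintype.card Y)
    (hconst : ∀ f, (∀ z, relOp D (relOp C f) z = (γ * δ : ℕ) * f z) → ∃ c, ∀ z, f z = c) :
    IsNut (blockGraph hC hD hR hS lC lD) := by
  have hm : (Fintype.card X : ℝ) ≠ 0 := by simp
  have ht : (Fintype.card Y : ℝ) ≠ 0 := by simp
  have hdet' : (γ * α * (δ * β) : ℝ) = Fintype.card X * Fintype.card Y := by exact_mod_cast hdet
  have hne : (γ * α * (δ * β) : ℝ) ≠ 0 := by rw [hdet']; exact mul_ne_zero hm ht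
  have hγ : (γ : ℝ) ≠ 0 := by rintro h; simp [h] at hne
  have hα : (α : ℝ) ≠ 0 := by rintro h; simp [h] at hne
  have hβ : (β : ℝ) ≠ 0 := by rintro h; simp [h] at hne
  -- With these values the left equation holds identically; the right one is `hdet`.
  refine isNut_of_eigenvector _
    (Sum.elim (fun _ => (Fintype.card Y : ℝ)) fun _ => -(γ * α : ℝ)) ?_ ?_ ?_
  · rintro (p | p)
    · exact ht
    · exact neg_ne_zero.2 (mul_ne_zero hγ hα)
  · change relOp (blockRel C D R S) _ = 0
    ext (p | p)
    · rw [relOp_blockRel_inl]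
      simp only [Sum.elim_inl, Sum.elim_inr, relOp_const (hC.prod hR)]
      simp
      ring
    · rw [relOp_blockRel_inr]
      simp only [Sum.elim_inl, Sum.elim_inr, relOp_const (hD.prod hS)]
      simp
      linarith
  · intro f hf
    change relOp (blockRel C D R S) f = 0 at hf
    set E : Z → ℝ := fun z => ∑ x, f (.inl (z, x)) with hE
    set F : Z → ℝ := fun z => ∑ y, f (.inr (z, y)) with hF
    obtain ⟨e1, e2⟩ := eq_fibre_mean hC.inj hR (fun q => f (.inl q)) (fun z => -F z) fun p => by
      have := congrFun hf (.inl p)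
      rw [relOp_blockRel_inl] at this
      simp only [Pi.zero_apply] at this
      simp only [hF]
      linarith
    obtain ⟨f1, f2⟩ := eq_fibre_mean hD.inj hS (fun q => f (.inr q)) (fun z => -E z) fun p => by
      have := congrFun hf (.inr p)
      rw [relOp_blockRel_inr] at this
      simp only [Pi.zero_apply] at this
      simp only [hE]
      linarith
    change ∀ z, α * relOp C E z = _ at e1
    change ∀ z, β * relOp D F z = _ at f1
    change ∀ p : Z × X, f (.inl p) = E p.1 / _ at e2
    change ∀ p : Z × Y, f (.inr p) = F p.1 / _ at f2
    have hCE : relOp C E = (-(Fintype.card X : ℝ) / α) • F := by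
      ext z
      have := e1 z
      simp only [Pi.smul_apply, smul_eq_mul]
      field_simp
      linarith
    -- Eliminating `F` gives the eigenvalue `|X| |Y| / (α β)`, which `hdet` identifies with `γ δ`.
    obtain ⟨c, hc⟩ := hconst E fun z => by
      rw [hCE, map_smul]
      have := f1 z
      simp only [Pi.smul_apply, smul_eq_mul]
      push_cast
      have h1 : relOp D F z = -(Fintype.card Y * E z) / β := by
        field_simp
        linarith
      rw [h1]
      field_simp
      linear_combination (-E z) * hdet'
    have hFc : ∀ z, F z = -(α * γ * c) / Fintype.card X := by
      intro z
      have := e1 z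
      rw [show E = fun _ => c from funext hc, relOp_const hC] at this
      field_simp
      linarith
    refine ⟨c / (Fintype.card X * Fintype.card Y), ?_⟩
    ext (p | p)
    · rw [e2, hc]
      simp only [Pi.smul_apply, Sum.elim_inl, smul_eq_mul]
      field_simp
    · rw [f2, hFc]
      simp only [Pi.smul_apply, Sum.elim_inr, smul_eq_mul]
      field_simp

/-- Automorphisms of the block graph from automorphisms of the constituents. -/
def blockIso {σ : Equiv.Perm Z} {τ : Equiv.Perm X} {υ : Equiv.Perm Y} (h1 : Preserves σ C)
    (h2 : Preserves σ D) (h3 : Preserves τ R) (h4 : Preserves υ S) :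
    blockGraph hC hD hR hS lC lD ≃g blockGraph hC hD hR hS lC lD where
  toEquiv := Equiv.sumCongr (Equiv.prodCongr σ τ) (Equiv.prodCongr σ υ)
  map_rel_iff' := by
    rintro (p | p) (q | q)
    · exact h1.prod h3 p q
    · exact σ.apply_eq_iff_eq
    · exact σ.apply_eq_iff_eq
    · exact h2.prod h4 p q

lemma relOp_adj_iso {V : Type} [Fintype V] (G : SimpleGraph V) (φ : G ≃g G) (v : V) :
    relOp G.Adj (fun _ => 1) (φ v) = relOp G.Adj (fun _ => 1) v := by
  classical
  simp only [relOp_apply]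
  rw [← Equiv.sum_comp φ.toEquiv]
  refine Finset.sum_congr rfl fun w _ => ?_
  have : G.Adj (φ v) (φ w) ↔ G.Adj v w := φ.map_rel_iff
  simp [this]

/-- The two sides of `hne` are the vertex degrees in the two parts. -/
lemma isLeft_iso (hne : Fintype.card Y + γ * α ≠ Fintype.card X + δ * β)
    (φ : blockGraph hC hD hR hS lC lD ≃g blockGraph hC hD hR hS lC lD)
    (v : (Z × X) ⊕ (Z × Y)) : (φ v).isLeft = v.isLeft := by
  have key : ∀ v, relOp (blockGraph hC hD hR hS lC lD).Adj (fun _ => 1) v =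
      if v.isLeft then ((Fintype.card Y + γ * α : ℕ) : ℝ)
        else ((Fintype.card X + δ * β : ℕ) : ℝ) := by
    change ∀ v, relOp (blockRel C D R S) _ _ = _
    rintro (p | p)
    · rw [relOp_blockRel_inl, (hC.prod hR).deg]
      simp [add_comm]
    · rw [relOp_blockRel_inr, (hD.prod hS).deg]
      simp [add_comm]
  have h := relOp_adj_iso _ φ v
  rw [key, key] at h
  cases h1 : (φ v).isLeft <;> cases h2 : v.isLeft <;>
    simp only [h1, h2, if_true, if_false, Nat.cast_inj, Bool.false_eq_true] at h ⊢
  · exact absurd h.symm hne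
  · exact absurd h hne

lemma card_quotient_eq {A B : Type} (s : Setoid A) (f : A → B) (hf : Function.Surjective f)
    (h : ∀ a b, s a b ↔ f a = f b) : Nat.card (Quotient s) = Nat.card B := by
  refine Nat.card_congr (Equiv.ofBijective (Quotient.lift f fun a b hab => (h a b).1 hab) ⟨?_, ?_⟩)
  · rintro ⟨a⟩ ⟨b⟩ hab
    exact Quotient.sound ((h a b).2 hab)
  · intro b
    obtain ⟨a, rfl⟩ := hf b
    exact ⟨Quotient.mk _ a, rfl⟩

-- The edges between the parts force the same `σ` on both first coordinates, so it must preserve `C`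
-- and `D` simultaneously.
variable (hne : Fintype.card Y + γ * α ≠ Fintype.card X + δ * β)
  (aC : ∀ i j i' j', C i j → C i' j' →
    ∃ σ : Equiv.Perm Z, Preserves σ C ∧ Preserves σ D ∧ σ i = i' ∧ σ j = j')
  (aD : ∀ i j i' j', D i j → D i' j' →
    ∃ σ : Equiv.Perm Z, Preserves σ C ∧ Preserves σ D ∧ σ i = i' ∧ σ j = j')
  (hα : 0 < α) (hβ : 0 < β) (hγ : 0 < γ)

include hC aC hγ in
omit [Fintype X] [Fintype Y] in
lemma exists_preserves_both (i i' : Z) :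
    ∃ σ : Equiv.Perm Z, Preserves σ C ∧ Preserves σ D ∧ σ i = i' := by
  obtain ⟨j, hj⟩ := hC.exists_rel hγ i
  obtain ⟨j', hj'⟩ := hC.exists_rel hγ i'
  obtain ⟨σ, h1, h2, h3, -⟩ := aC _ _ _ _ hj hj'
  exact ⟨σ, h1, h2, h3⟩

omit [Fintype X] in
lemma preserves_one (R : X → X → Prop) : Preserves 1 R := fun _ _ => Iff.rfl

include hne aC hα hβ hγ in
lemma vertexOrbitCount_blockGraph [Nonempty X] [Nonempty Y] [Nonempty Z] :
    vertexOrbitCount (blockGraph hC hD hR hS lC lD) = 2 := by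
  have : Nat.card Bool = 2 := by simp
  rw [← this]
  refine card_quotient_eq _ Sum.isLeft ?_ fun v w => ?_
  · obtain ⟨x⟩ := ‹Nonempty X›
    obtain ⟨y⟩ := ‹Nonempty Y›
    obtain ⟨z⟩ := ‹Nonempty Z›
    rintro (_ | _)
    exacts [⟨.inr (z, y), rfl⟩, ⟨.inl (z, x), rfl⟩]
  · rw [MulAction.orbitRel_apply, MulAction.mem_orbit_iff]
    constructor
    · rintro ⟨φ, rfl⟩
      exact isLeft_iso hC hD hR hS lC lD hne φ w
    · intro h
      rcases v with ⟨i, u⟩ | ⟨i, u⟩ <;> rcases w with ⟨j, w⟩ | ⟨j, w⟩ <;> simp at h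
      · obtain ⟨σ, h1, h2, h3⟩ := exists_preserves_both hC aC hγ j i
        obtain ⟨τ, h4, h5⟩ := hR.exists_preserves hα w u
        exact ⟨blockIso hC hD hR hS lC lD h1 h2 h4 (preserves_one S),
          congrArg Sum.inl (Prod.ext h3 h5)⟩
      · obtain ⟨σ, h1, h2, h3⟩ := exists_preserves_both hC aC hγ j i
        obtain ⟨υ, h4, h5⟩ := hS.exists_preserves hβ w u
        exact ⟨blockIso hC hD hR hS lC lD h1 h2 (preserves_one R) h4,
          congrArg Sum.inr (Prod.ext h3 h5)⟩

include aC aD hα hβ hγ in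
/-- Arcs with the same pattern of parts are equivalent under automorphisms. -/
lemma exists_iso_of_arcs {a b a' b' : (Z × X) ⊕ (Z × Y)} (h : blockRel C D R S a b)
    (h' : blockRel C D R S a' b') (ha : a.isLeft = a'.isLeft) (hb : b.isLeft = b'.isLeft) :
    ∃ φ : blockGraph hC hD hR hS lC lD ≃g blockGraph hC hD hR hS lC lD,
      φ a = a' ∧ φ b = b' := by
  rcases a with ⟨i, u⟩ | ⟨i, u⟩ <;> rcases a' with ⟨i', u'⟩ | ⟨i', u'⟩ <;>
    rcases b with ⟨j, w⟩ | ⟨j, w⟩ <;> rcases b' with ⟨j', w'⟩ | ⟨j', w'⟩ <;>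
    simp at ha hb
  · obtain ⟨σ, h1, h2, h3, h4⟩ := aC _ _ _ _ h.1 h'.1
    obtain ⟨τ, k1, k2, k3⟩ := hR.arc _ _ _ _ h.2 h'.2
    exact ⟨blockIso hC hD hR hS lC lD h1 h2 k1 (preserves_one S),
      congrArg Sum.inl (Prod.ext h3 k2), congrArg Sum.inl (Prod.ext h4 k3)⟩
  -- A cross arc has a single `Z`-coordinate, so vertex-transitivity on each of the three factors
  -- suffices.
  · obtain ⟨σ, h1, h2, h3⟩ := exists_preserves_both hC aC hγ i i'
    obtain ⟨τ, k1, k2⟩ := hR.exists_preserves hα u u'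
    obtain ⟨υ, l1, l2⟩ := hS.exists_preserves hβ w w'
    obtain rfl : i = j := h
    obtain rfl : i' = j' := h'
    exact ⟨blockIso hC hD hR hS lC lD h1 h2 k1 l1,
      congrArg Sum.inl (Prod.ext h3 k2), congrArg Sum.inr (Prod.ext h3 l2)⟩
  · obtain ⟨σ, h1, h2, h3⟩ := exists_preserves_both hC aC hγ i i'
    obtain ⟨υ, k1, k2⟩ := hS.exists_preserves hβ u u'
    obtain ⟨τ, l1, l2⟩ := hR.exists_preserves hα w w'
    obtain rfl : i = j := h
    obtain rfl : i' = j' := h'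
    exact ⟨blockIso hC hD hR hS lC lD h1 h2 l1 k1,
      congrArg Sum.inr (Prod.ext h3 k2), congrArg Sum.inl (Prod.ext h3 l2)⟩
  · obtain ⟨σ, h1, h2, h3, h4⟩ := aD _ _ _ _ h.1 h'.1
    obtain ⟨υ, k1, k2, k3⟩ := hS.arc _ _ _ _ h.2 h'.2
    exact ⟨blockIso hC hD hR hS lC lD h1 h2 (preserves_one R) k1,
      congrArg Sum.inr (Prod.ext h3 k2), congrArg Sum.inr (Prod.ext h4 k3)⟩

-- The invariant of an edge is its unordered pair of parts, an element of the three-element type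
-- `Sym2 Bool`.
include hne aC aD hα hβ hγ in
lemma edgeOrbitCount_blockGraph [Nonempty X] [Nonempty Y] [Nonempty Z] (hδ : 0 < δ) :
    edgeOrbitCount (blockGraph hC hD hR hS lC lD) = 3 := by
  have : Nat.card (Sym2 Bool) = 3 := by
    rw [Nat.card_eq_fintype_card]
    decide
  rw [← this]
  refine card_quotient_eq _ (fun e => Sym2.map Sum.isLeft e.1) ?_ ?_
  · obtain ⟨x⟩ := ‹Nonempty X›
    obtain ⟨y⟩ := ‹Nonempty Y›
    obtain ⟨z⟩ := ‹Nonempty Z›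
    obtain ⟨p, hp⟩ := (hC.prod hR).exists_rel (by positivity) (z, x)
    obtain ⟨q, hq⟩ := (hD.prod hS).exists_rel (by positivity) (z, y)
    intro k
    induction k using Sym2.ind with
    | _ k l =>
      cases k <;> cases l
      · exact ⟨⟨s(.inr (z, y), .inr q), hq⟩, rfl⟩
      · exact ⟨⟨s(.inr (z, y), .inl (z, x)), rfl⟩, rfl⟩
      · exact ⟨⟨s(.inl (z, x), .inr (z, y)), rfl⟩, rfl⟩
      · exact ⟨⟨s(.inl (z, x), .inl p), hp⟩, rfl⟩
  · rintro ⟨e, he⟩ ⟨f, hf⟩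
    induction e using Sym2.ind with
    | _ a b =>
    induction f using Sym2.ind with
    | _ c d =>
    constructor
    · rintro ⟨φ, hφ⟩
      have h1 : Sym2.map φ s(a, b) = s(c, d) := congrArg Subtype.val hφ
      simp only
      rw [← h1]
      simp [isLeft_iso hC hD hR hS lC lD hne]
    · intro h
      have h0 : s(a.isLeft, b.isLeft) = s(c.isLeft, d.isLeft) := h
      rw [Sym2.eq_iff] at h0
      rcases h0 with ⟨h1, h2⟩ | ⟨h1, h2⟩
      · obtain ⟨φ, k1, k2⟩ := exists_iso_of_arcs hC hD hR hS lC lD aC aD hα hβ hγ he hf h1 h2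
        refine ⟨φ, Subtype.ext ?_⟩
        change s(φ a, φ b) = s(c, d)
        rw [k1, k2]
      · obtain ⟨φ, k1, k2⟩ := exists_iso_of_arcs hC hD hR hS lC lD aC aD hα hβ hγ he
          (SimpleGraph.Adj.symm (G := blockGraph hC hD hR hS lC lD) hf) h1 h2
        refine ⟨φ, Subtype.ext ?_⟩
        change s(φ a, φ b) = s(c, d)
        rw [k1, k2, Sym2.eq_swap]

end Block

/-! ### Available pairs of order and degree -/

/-- There is an arc-transitive regular relation of degree `a` on `m` points with nonsingular
adjacency operator. -/
def HasArcRegular (m a : ℕ) : Prop :=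
  ∃ (X : Type) (_ : Fintype X) (R : X → X → Prop), Fintype.card X = m ∧ ArcRegular R a

/-- As `HasArcRegular`, for a relation without loops. -/
def HasArcRegularGraph (m a : ℕ) : Prop :=
  ∃ (X : Type) (_ : Fintype X) (R : X → X → Prop),
    Fintype.card X = m ∧ ArcRegular R a ∧ ∀ x, ¬ R x x

lemma HasArcRegularGraph.hasArcRegular {m a : ℕ} (h : HasArcRegularGraph m a) :
    HasArcRegular m a := by
  obtain ⟨X, _, R, h1, h2, -⟩ := h
  exact ⟨X, _, R, h1, h2⟩

lemma HasArcRegular.mul {m a k b : ℕ} (h : HasArcRegular m a) (h' : HasArcRegular k b) :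
    HasArcRegular (m * k) (a * b) := by
  obtain ⟨X, _, R, h1, h2⟩ := h
  obtain ⟨Y, _, S, k1, k2⟩ := h'
  exact ⟨X × Y, inferInstance, prodRel R S, by simp [h1, k1], h2.prod k2⟩

lemma HasArcRegular.mul_graph {m a k b : ℕ} (h : HasArcRegular m a)
    (h' : HasArcRegularGraph k b) : HasArcRegularGraph (m * k) (a * b) := by
  obtain ⟨X, _, R, h1, h2⟩ := h
  obtain ⟨Y, _, S, k1, k2, k3⟩ := h'
  exact ⟨X × Y, inferInstance, prodRel R S, by simp [h1, k1], h2.prod k2, fun p hp => k3 _ hp.2⟩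

lemma hasArcRegular_one (k : ℕ) : HasArcRegular k 1 :=
  ⟨Fin k, inferInstance, _, by simp, arcRegular_eq⟩

lemma hasArcRegularGraph_complete {k : ℕ} (hk : 2 ≤ k) : HasArcRegularGraph k (k - 1) :=
  ⟨Fin k, inferInstance, fun x y => x ≠ y, by simp,
    by simpa using arcRegular_ne (X := Fin k) (by simpa using hk), fun x h => h rfl⟩

lemma hasArcRegularGraph_root {p d : ℕ} (hp : p.Prime) (hd : d ∣ p - 1) (he : Even d) :
    HasArcRegularGraph p d := by
  have : Fact p.Prime := ⟨hp⟩
  refine ⟨ZMod p, inferInstance, rootRel p d, ZMod.card p, arcRegular_rootRel hd he, fun x h => ?_⟩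
  have hd0 : d ≠ 0 := by
    rintro rfl
    have := hp.two_le
    have := Nat.eq_zero_of_zero_dvd hd
    omega
  simp [rootRel, hd0] at h

lemma hasArcRegular_prod {r : ℕ} (m a : Fin r → ℕ) (h : ∀ i, HasArcRegular (m i) (a i)) :
    HasArcRegular (∏ i, m i) (∏ i, a i) := by
  induction r with
  | zero => simpa using hasArcRegular_one 1
  | succ r ih =>
    rw [Fin.prod_univ_castSucc, Fin.prod_univ_castSucc]
    exact (ih _ _ fun i => h _).mul (h _)

lemma hasArcRegularGraph_prod {r : ℕ} (m a : Fin r → ℕ) (hr : r ≠ 0)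
    (h : ∀ i, HasArcRegularGraph (m i) (a i)) : HasArcRegularGraph (∏ i, m i) (∏ i, a i) := by
  cases r with
  | zero => exact absurd rfl hr
  | succ r =>
    rw [Fin.prod_univ_castSucc, Fin.prod_univ_castSucc]
    exact (hasArcRegular_prod _ _ fun i => (h _).hasArcRegular).mul_graph (h _)

/-! ### The two families of nut graphs -/

section Existence

variable {n m t a b : ℕ} (hn : 3 ≤ n) (hodd : Odd n) (hm : 0 < m) (ht : 0 < t)
include hn hodd hm ht

/-- Case `κ = 4`: the cycle on both sides already excludes loops, so `R` and `S` may have them. -/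
lemma exists_nut_of_cycleRel (hR : HasArcRegular m a) (hS : HasArcRegular t b)
    (hdet : 4 * a * b = m * t) (hne : t + 2 * a ≠ m + 2 * b) :
    ExistsNutGraphTwoThree (n * (m + t)) := by
  have : NeZero n := ⟨by omega⟩
  have : Fact (1 < n) := ⟨by omega⟩
  obtain ⟨X, _, R, rfl, hR⟩ := hR
  obtain ⟨Y, _, S, rfl, hS⟩ := hS
  have hC := arcRegular_cycleRel hn hodd
  have lC : ∀ z : ZMod n, ¬ cycleRel n z z := by simp [cycleRel, eq_sub_iff_add_eq]
  have hX : Nonempty X := Fintype.card_pos_iff.1 hm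
  have hY : Nonempty Y := Fintype.card_pos_iff.1 ht
  have hab : 0 < a * b := by
    have := Nat.mul_pos hm ht
    rw [← hdet, mul_assoc] at this
    omega
  have ha : 0 < a := Nat.pos_of_mul_pos_right hab
  have hb : 0 < b := Nat.pos_of_mul_pos_left hab
  have aC : ∀ i j i' j', cycleRel n i j → cycleRel n i' j' → ∃ σ : Equiv.Perm (ZMod n),
      Preserves σ (cycleRel n) ∧ Preserves σ (cycleRel n) ∧ σ i = i' ∧ σ j = j' := by
    intro i j i' j' h h'
    obtain ⟨σ, h1, h2⟩ := hC.arc _ _ _ _ h h'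
    exact ⟨σ, h1, h1, h2⟩
  refine ⟨(ZMod n × X) ⊕ (ZMod n × Y), inferInstance,
    blockGraph hC hC hR hS lC fun z _ h => lC z h.1, ?_, ?_, ?_, ?_⟩
  · simp [ZMod.card, mul_add]
  · refine isNut_blockGraph hC hC hR hS _ _ (by rw [← hdet]; ring) fun f hf => ?_
    exact const_of_relOp_cycleRel_sq hn hodd f fun i => by simpa using hf i
  · exact vertexOrbitCount_blockGraph hC hC hR hS _ _ hne aC ha hb two_pos
  · exact edgeOrbitCount_blockGraph hC hC hR hS _ _ hne aC aC ha hb two_pos two_pos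

/-- Case `κ = 2`: `D` is equality, so looplessness on the right has to come from `S`. -/
lemma exists_nut_of_eq (hR : HasArcRegular m a) (hS : HasArcRegularGraph t b)
    (hdet : 2 * a * b = m * t) (hne : t + 2 * a ≠ m + b) :
    ExistsNutGraphTwoThree (n * (m + t)) := by
  have : NeZero n := ⟨by omega⟩
  have : Fact (1 < n) := ⟨by omega⟩
  obtain ⟨X, _, R, rfl, hR⟩ := hR
  obtain ⟨Y, _, S, rfl, hS, lS⟩ := hS
  have hC := arcRegular_cycleRel hn hodd
  have hD := arcRegular_eq (X := ZMod n)
  have lC : ∀ z : ZMod n, ¬ cycleRel n z z := by simp [cycleRel, eq_sub_iff_add_eq]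
  have hX : Nonempty X := Fintype.card_pos_iff.1 hm
  have hY : Nonempty Y := Fintype.card_pos_iff.1 ht
  have hab : 0 < a * b := by
    have := Nat.mul_pos hm ht
    rw [← hdet, mul_assoc] at this
    omega
  have ha : 0 < a := Nat.pos_of_mul_pos_right hab
  have hb : 0 < b := Nat.pos_of_mul_pos_left hab
  have hne' : Fintype.card Y + 2 * a ≠ Fintype.card X + 1 * b := by rwa [one_mul]
  have aC : ∀ i j i' j', cycleRel n i j → cycleRel n i' j' → ∃ σ : Equiv.Perm (ZMod n),
      Preserves σ (cycleRel n) ∧ Preserves σ (fun x y => x = y) ∧ σ i = i' ∧ σ j = j' := by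
    intro i j i' j' h h'
    obtain ⟨σ, h1, h2⟩ := hC.arc _ _ _ _ h h'
    exact ⟨σ, h1, fun x y => by simp, h2⟩
  have aD : ∀ i j i' j' : ZMod n, i = j → i' = j' → ∃ σ : Equiv.Perm (ZMod n),
      Preserves σ (cycleRel n) ∧ Preserves σ (fun x y => x = y) ∧ σ i = i' ∧ σ j = j' := by
    rintro i _ i' _ rfl rfl
    obtain ⟨σ, h1, h2⟩ := hC.exists_preserves two_pos i i'
    exact ⟨σ, h1, fun x y => by simp, h2, h2⟩
  refine ⟨(ZMod n × X) ⊕ (ZMod n × Y), inferInstance,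
    blockGraph hC hD hR hS lC fun _ y h => lS y h.2, ?_, ?_, ?_, ?_⟩
  · simp [ZMod.card, mul_add]
  · refine isNut_blockGraph hC hD hR hS _ _ (by rw [← hdet]; ring) fun f hf => ?_
    refine const_of_relOp_cycleRel hn f fun i => ?_
    have := hf i
    rw [relOp_eq] at this
    simpa using this
  · exact vertexOrbitCount_blockGraph hC hD hR hS _ _ hne' aC ha hb two_pos
  · exact edgeOrbitCount_blockGraph hC hD hR hS _ _ hne' aC aD ha hb two_pos one_pos

end Existence

end NutGraphs

/-! ### Assembling the factors -/

open NutGraphs in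
theorem mainTheorem3 (n : ℕ) (hn : 3 ≤ n) (hodd : Odd n) :
    (∀ (m t : ℕ), Odd m → 2 ≤ t → Even t →
      -- factorizations of `m` and `t`
      ∀ (r₁ q₁ r₂ q₂ m₀ t₀ : ℕ), 1 ≤ m₀ → 1 ≤ t₀ →
      ∀ (mp : Fin r₁ → ℕ) (mc : Fin q₁ → ℕ) (tp : Fin r₂ → ℕ) (tc : Fin q₂ → ℕ),
      (∀ i, (mp i).Prime ∧ Odd (mp i)) → (∀ i, 2 ≤ mc i) →
      (∀ j, (tp j).Prime ∧ Odd (tp j)) → (∀ j, 2 ≤ tc j) →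
      m = m₀ * (∏ i, mp i) * (∏ i, mc i) →
      t = t₀ * (∏ j, tp j) * (∏ j, tc j) →
      -- even divisors `d i ∣ mp i - 1`, `d' j ∣ tp j - 1`, and `κ ∈ {2, 4}`
      ∀ (d : Fin r₁ → ℕ) (d' : Fin r₂ → ℕ) (κ : ℕ),
      (∀ i, Even (d i) ∧ d i ∣ mp i - 1) → (∀ j, Even (d' j) ∧ d' j ∣ tp j - 1) →
      (κ = 2 ∨ κ = 4) →
      κ * (∏ i, d i) * (∏ j, d' j) * (∏ i, (mc i - 1)) * (∏ j, (tc j - 1)) = m * t →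
      t + 2 * (∏ i, d i) * (∏ i, (mc i - 1)) ≠
        m + κ / 2 * (∏ j, d' j) * (∏ j, (tc j - 1)) →
      NutGraphs.ExistsNutGraphTwoThree (n * (m + t))) ∧
    (∀ s ∈ ({3, 5, 7, 11, 13, 29, 31, 37, 41, 47, 53, 59, 83, 101, 103, 109, 127, 131, 137,
        139} : Set ℕ),
      NutGraphs.ExistsNutGraphTwoThree (n * s)) := by
  have K : ∀ {k : ℕ}, 2 ≤ k → HasArcRegularGraph k (k - 1) := hasArcRegularGraph_complete
  have I := hasArcRegular_one
  constructor
  · intro m t hmo ht2 hte r₁ q₁ r₂ q₂ m₀ t₀ hm₀ ht₀ mp mc tp tc hmp hmc htp htc hm ht d d' κ hd hd'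
      hκ hdet hne
    have hm0 : 0 < m := hmo.pos
    have ht0 : 0 < t := by omega
    have hP : HasArcRegular (∏ i, mp i) (∏ i, d i) :=
      hasArcRegular_prod _ _ fun i =>
        (hasArcRegularGraph_root (hmp i).1 (hd i).2 (hd i).1).hasArcRegular
    have hQ : HasArcRegular (∏ i, mc i) (∏ i, (mc i - 1)) :=
      hasArcRegular_prod _ _ fun i => (K (hmc i)).hasArcRegular
    have hP' : ∀ j, HasArcRegularGraph (tp j) (d' j) :=
      fun j => hasArcRegularGraph_root (htp j).1 (hd' j).2 (hd' j).1
    have hP'' := hasArcRegular_prod _ _ fun j => (hP' j).hasArcRegular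
    have hQ' := hasArcRegular_prod _ _ fun j => (K (htc j)).hasArcRegular
    have hR : HasArcRegular m ((∏ i, d i) * ∏ i, (mc i - 1)) := by
      -- The factor `m₀` carries the equality relation, of degree 1.
      rw [hm, ← one_mul (∏ i, d i)]
      exact ((I m₀).mul hP).mul hQ
    rcases hκ with rfl | rfl
    · have hS : HasArcRegularGraph t ((∏ j, d' j) * ∏ j, (tc j - 1)) := by
        -- One loopless factor makes the product loopless. If `t` has no such factor, then `2 a = m
        -- t` with `a ≤ m` forces `t = 2`, and `K₂`, also of degree 1, replaces equality.
        by_cases hr : r₂ = 0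
        · by_cases hq : q₂ = 0
          · subst hr hq
            have h1 : (∏ i, d i) * ∏ i, (mc i - 1) ≤ m := by
              rw [hm, mul_assoc]
              refine (Nat.mul_le_mul (Finset.prod_le_prod' fun i _ => ?_)
                (Finset.prod_le_prod' fun i _ => Nat.sub_le (mc i) 1)).trans
                (Nat.le_mul_of_pos_left _ hm₀)
              have := (hmp i).1.two_le
              exact (Nat.le_of_dvd (by omega) (hd i).2).trans (Nat.sub_le _ _)
            have h2 : t = 2 := by
              simp only [Finset.univ_eq_empty, Finset.prod_empty, mul_one] at hdet
              have : m * t ≤ m * 2 := by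
                rw [← hdet, mul_assoc, mul_comm m]
                exact Nat.mul_le_mul_left _ h1
              have := Nat.le_of_mul_le_mul_left this hm0
              omega
            subst h2
            simpa using K le_rfl
          · rw [ht, ← one_mul (∏ j, d' j)]
            exact ((I t₀).mul hP'').mul_graph
              (hasArcRegularGraph_prod _ _ hq fun j => K (htc j))
        · rw [ht, ← one_mul (∏ j, d' j), mul_right_comm, mul_right_comm 1]
          exact ((I t₀).mul hQ').mul_graph (hasArcRegularGraph_prod _ _ hr hP')
      refine exists_nut_of_eq hn hodd hm0 ht0 hR hS (by rw [← hdet]; ring) ?_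
      simpa [mul_assoc] using hne
    · have hS : HasArcRegular t ((∏ j, d' j) * ∏ j, (tc j - 1)) := by
        rw [ht, ← one_mul (∏ j, d' j)]
        exact ((I t₀).mul hP'').mul hQ'
      refine exists_nut_of_cycleRel hn hodd hm0 ht0 hR hS (by rw [← hdet]; ring) ?_
      simpa [mul_assoc] using hne
  · have G : ∀ {k : ℕ}, 2 ≤ k → HasArcRegular k (k - 1) := fun h => (K h).hasArcRegular
    have root : ∀ {p d : ℕ}, p.Prime → d ∣ p - 1 → Even d → HasArcRegular p d :=
      fun h h' h'' => (hasArcRegularGraph_root h h' h'').hasArcRegular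
    have four : ∀ {m t a b : ℕ}, HasArcRegular m a → HasArcRegular t b →
        (0 < m ∧ 0 < t ∧ 4 * a * b = m * t ∧ t + 2 * a ≠ m + 2 * b) →
        ExistsNutGraphTwoThree (n * (m + t)) := fun hR hS h =>
      exists_nut_of_cycleRel hn hodd h.1 h.2.1 hR hS h.2.2.1 h.2.2.2
    have two : ∀ {m t a b : ℕ}, HasArcRegular m a → HasArcRegularGraph t b →
        (0 < m ∧ 0 < t ∧ 2 * a * b = m * t ∧ t + 2 * a ≠ m + b) →
        ExistsNutGraphTwoThree (n * (m + t)) := fun hR hS h =>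
      exists_nut_of_eq hn hodd h.1 h.2.1 hR hS h.2.2.1 h.2.2.2
    intro s hs
    simp only [Set.mem_insert_iff, Set.mem_singleton_iff] at hs
    -- Each `s` is split as `m + t` with degrees `a`, `b` satisfying `κ a b = m t`. `I k`
    -- contributes the ratio `1` of degree to order, `G` and `K` the ratio `(k - 1) / k`, and `root`
    -- the ratio `d / p`.
    rcases hs with rfl | rfl | rfl | rfl | rfl | rfl | rfl | rfl | rfl | rfl | rfl | rfl | rfl |
      rfl | rfl | rfl | rfl | rfl | rfl | rfl
    · exact two (I 1) (K (k := 2) (by norm_num)) (by norm_num)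
    · exact four (I 1) (I 4) (by norm_num)
    · exact four (I 3) (G (k := 4) (by norm_num)) (by norm_num)
    · exact four (G (k := 3) (by norm_num)) ((I 2).mul (G (k := 4) (by norm_num))) (by norm_num)
    · exact four (I 1) ((I 3).mul (G (k := 4) (by norm_num))) (by norm_num)
    · exact four ((I 3).mul (G (k := 7) (by norm_num))) (G (k := 8) (by norm_num)) (by norm_num)
    · exact four (G (k := 7) (by norm_num)) ((I 3).mul (G (k := 8) (by norm_num))) (by norm_num)
    · exact four ((G (k := 7) (by norm_num)).mul (G (k := 3) (by norm_num)))
        ((I 2).mul (G (k := 8) (by norm_num))) (by norm_num)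
    · exact four (G (k := 9) (by norm_num))
        (((I 2).mul (G (k := 4) (by norm_num))).mul (G (k := 4) (by norm_num))) (by norm_num)
    · exact four ((G (k := 5) (by norm_num)).mul (G (k := 3) (by norm_num)))
        ((I 2).mul (G (k := 16) (by norm_num))) (by norm_num)
    · exact four (G (k := 5) (by norm_num)) ((I 3).mul (G (k := 16) (by norm_num))) (by norm_num)
    · exact four (I 3) ((G (k := 8) (by norm_num)).mul (G (k := 7) (by norm_num))) (by norm_num)
    · exact four (I 3) ((G (k := 16) (by norm_num)).mul (G (k := 5) (by norm_num))) (by norm_num)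
    · exact four (G (k := 5) (by norm_num))
        (((I 2).mul (G (k := 16) (by norm_num))).mul (G (k := 3) (by norm_num))) (by norm_num)
    · exact two ((G (k := 11) (by norm_num)).mul (G (k := 5) (by norm_num)))
        ((G (k := 12) (by norm_num)).mul_graph (K (k := 4) (by norm_num))) (by norm_num)
    · exact two ((G (k := 9) (by norm_num)).mul (G (k := 5) (by norm_num)))
        ((G (k := 16) (by norm_num)).mul_graph (K (k := 4) (by norm_num))) (by norm_num)
    · exact four (G (k := 15) (by norm_num)) ((G (k := 16) (by norm_num)).mul
        (root (p := 7) (d := 2) (by norm_num) (by norm_num) (by decide))) (by norm_num)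
    · exact four ((G (k := 7) (by norm_num)).mul (G (k := 5) (by norm_num)))
        (((I 2).mul (G (k := 8) (by norm_num))).mul (G (k := 6) (by norm_num))) (by norm_num)
    · exact two ((G (k := 21) (by norm_num)).mul (G (k := 5) (by norm_num)))
        ((G (k := 8) (by norm_num)).mul_graph (K (k := 4) (by norm_num))) (by norm_num)
    · exact four (root (p := 19) (d := 6) (by norm_num) (by norm_num) (by decide))
        ((G (k := 20) (by norm_num)).mul (G (k := 6) (by norm_num))) (by norm_num)
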